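/- **Setting (spatial Demographic Prisoner's Dilemma).** Fix integers $m,K\ge 1$, rates $v>0$, $d>0$, $b\ge 0$, wealth parameters $0<w_0<w_c$, and payoffs $R,S,T,P$ with $T>R>0$ and $S>P>0$. A configuration is an element $\sigma=(X^i,Y^i,Z^i)_{1\le i\le K}$ of $\big((\mathbb Z/m\mathbb Z)^2\times\mathbb R\times\{-1,0,1\}\big)^K$: $X^i$ is the position of individual $i$, $Y^i$ its wealth, and $Z^i$ its status ($0$: cooperator, $1$: defector, $-1$: not born yet). Configurations evolve as a continuous time Markov chain driven by independent Poisson clocks: * each $i$ has a movement clock of rate $d$; when it rings, $X^i$ moves to one of its four neighbouring sites, chosen uniformly; * each unordered pair $\{i,j\}$, $i\ne j$, has a game clock of rate $v$; when it rings, if $X^i=X^j$, $Y^i>0$, $Y^j>0$ and $Z^i,Z^j\neq -1$, then $i$ and $j$ play and their payoffs are added to their wealths, otherwise nothing happens. Two cooperators receive $R$ each; a cooperator meeting a defector receives $-S$ and the defector receives $T$; if both defect, a fair coin decides which of the two receives $-2P$, the other one receiving $0$; * each $i$ has a birth clock of rate $b$; when it rings, if $Z^i\ne-1$, $Y^i>w_c$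 and some index $j$ has $Z^j=-1$, such an index $j$ is chosen uniformly and one sets $X^j:=X^i$, $Y^j:=w_0$, $Z^j:=Z^i$ and replaces $Y^i$ by $Y^i-w_0$; otherwise nothing happens. An individual with $Z^i\in\{0,1\}$ is dead when $Y^i\le 0$; its index is not used again. Let $\mathbb P_\sigma$ be the law of the process $(\sigma_t)_{t\ge0}$ started from $\sigma$. **Theorem.** For all $v,d,K,b,w_0,w_c,m$ as above there is a constant $\mu>0$, depending only on $v,d,K,b,w_0,w_c,m$, such that for all payoffs $R,S,T,P$ as above with $\mu R<S$ and every initial configuration $\sigma$ with at least one defector with positive wealth, $$\mathbb P_\sigma\big(\text{there is } t_0\ge 0 \text{ such that at every time } t\ge t_0 \text{ every cooperator is dead}\big)=1 .$$ -/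

import Mathlib

open MeasureTheory ProbabilityTheory Filter
open scoped NNReal ENNReal

namespace DemographicPD

/-- The parameters of the dynamics other than the payoffs: the rate `v` of the game clock of each
pair of individuals, the rates `d` and `b` of the movement clock and of the birth clock of each
individual, the birth wealth `w₀` and the wealth threshold `wc` for giving birth. -/
structure Parameters where
  v : ℝ≥0
  d : ℝ≥0
  b : ℝ≥0
  w₀ : ℝ
  wc : ℝ
  v_pos : 0 < v
  d_pos : 0 < d
  w₀_pos : 0 < w₀
  w₀_lt_wc : w₀ < wc

/-- The payoffs: Reward `R`, Sucker payoff `-S`, Temptation `T`, Punishment `P`. -/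
structure Payoffs where
  R : ℝ
  S : ℝ
  T : ℝ
  P : ℝ
  R_pos : 0 < R
  R_lt_T : R < T
  P_pos : 0 < P
  P_lt_S : P < S

/-- The status `Z` of an index: a cooperator (`Z = 0`), a defector (`Z = 1`), or an individual
which is not born yet (`Z = -1`). -/
inductive Role where
  | unborn
  | cooperator
  | defector
  deriving DecidableEq

/-- The position `X`, the wealth `Y` and the status `Z` of an index. -/
structure Particle (m : ℕ) where
  pos : ZMod m × ZMod m
  wealth : ℝ
  role : Role

/-- Configurations `σ ∈ ((ℤ/mℤ)² × ℝ × {-1, 0, 1})^K`. -/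
def Config (m K : ℕ) : Type := Fin K → Particle m

/-- All the jump distributions are discrete (only countably many configurations can be reached from
a given one), so configurations carry the discrete σ-algebra. -/
instance (m K : ℕ) : MeasurableSpace (Config m K) := ⊤

/-- The four directions on the torus. -/
inductive Direction where
  | top
  | bottom
  | left
  | right
  deriving DecidableEq

instance : Fintype Direction where
  elems := {.top, .bottom, .left, .right}
  complete := fun e => by cases e <;> simp

instance : Nonempty Direction := ⟨Direction.top⟩

def Direction.vec (m : ℕ) : Direction → ZMod m × ZMod m
  | .top => (0, 1)
  | .bottom => (0, -1)
  | .left => (-1, 0)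
  | .right => (1, 0)

/-- Unordered pairs of distinct individuals. -/
abbrev Pair (K : ℕ) : Type := {p : Fin K × Fin K // p.1 < p.2}

/-- The Poisson clocks of the system: one movement clock for each individual, one game clock for
each pair of individuals, and one birth clock for each individual. -/
inductive Clock (K : ℕ) where
  | move (i : Fin K)
  | game (p : Pair K)
  | birth (i : Fin K)
  deriving DecidableEq, Fintype

section dynamics

variable {m K : ℕ}

noncomputable section

/-- The individual `i` takes part in the life of the system: it is born and its wealth is
positive. -/
def IsAlive (σ : Config m K) (i : Fin K) : Prop :=
  (σ i).role ≠ Role.unborn ∧ 0 < (σ i).wealth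

def IsLivingCooperator (σ : Config m K) (i : Fin K) : Prop :=
  (σ i).role = Role.cooperator ∧ 0 < (σ i).wealth

def IsLivingDefector (σ : Config m K) (i : Fin K) : Prop :=
  (σ i).role = Role.defector ∧ 0 < (σ i).wealth

/-! ### What happens when a clock rings -/

/-- Individual `i` makes a step in direction `e`. -/
def shift (σ : Config m K) (i : Fin K) (e : Direction) : Config m K :=
  fun k => if k = i then { σ k with pos := (σ k).pos + e.vec m } else σ k

/-- The amounts `u.1` and `u.2` are added to the wealths of `i` and `j`. -/
def addWealth (σ : Config m K) (i j : Fin K) (u : ℝ × ℝ) : Config m K :=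
  fun k =>
    if k = i then { σ k with wealth := (σ k).wealth + u.1 }
    else if k = j then { σ k with wealth := (σ k).wealth + u.2 }
    else σ k

/-- Individual `i` has an offspring, of index `j`, to which it gives the wealth `w₀`. -/
def addChild (w₀ : ℝ) (σ : Config m K) (i j : Fin K) : Config m K :=
  fun k =>
    if k = j then { pos := (σ i).pos, wealth := w₀, role := (σ i).role }
    else if k = i then { σ k with wealth := (σ k).wealth - w₀ }
    else σ k

/-- Movement: `i` moves to one of the four neighbouring sites, uniformly. -/
def moveLaw (σ : Config m K) (i : Fin K) : PMF (Config m K) :=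
  (PMF.uniformOfFintype Direction).map (shift σ i)

/-- The law of the pair of payoffs of a game between two individuals of given behaviours. When both
defect, a fair coin decides which of the two receives `-2P`, the other receives `0`. -/
def payoffLaw (G : Payoffs) : Role → Role → PMF (ℝ × ℝ)
  | .cooperator, .cooperator => PMF.pure (G.R, G.R)
  | .cooperator, .defector => PMF.pure (-G.S, G.T)
  | .defector, .cooperator => PMF.pure (G.T, -G.S)
  | .defector, .defector =>
      (PMF.uniformOfFintype Bool).map
        (fun heads => if heads then (-2 * G.P, 0) else (0, -2 * G.P))
  | _, _ => PMF.pure (0, 0)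

open Classical in
/-- Game: `i` and `j` play if both are alive and they are on the same site, otherwise nothing
happens. -/
def gameLaw (G : Payoffs) (σ : Config m K) (i j : Fin K) : PMF (Config m K) :=
  if IsAlive σ i ∧ IsAlive σ j ∧ (σ i).pos = (σ j).pos then
    (payoffLaw G (σ i).role (σ j).role).map (addWealth σ i j)
  else PMF.pure σ

/-- The indices available for an offspring. -/
def unbornSet (σ : Config m K) : Finset (Fin K) :=
  Finset.univ.filter (fun j => (σ j).role = Role.unborn)

open Classical in
/-- Birth: if `i` is born, has a wealth larger than `wc`, and if there is an available index, then
`i` has an offspring whose index is uniform among the available ones. Otherwise nothing happens. -/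
def birthLaw (A : Parameters) (σ : Config m K) (i : Fin K) : PMF (Config m K) :=
  if h : (σ i).role ≠ Role.unborn ∧ A.wc < (σ i).wealth ∧ (unbornSet σ).Nonempty then
    (PMF.uniformOfFinset (unbornSet σ) h.2.2).map (addChild A.w₀ σ i)
  else PMF.pure σ

/-- The law of the configuration after clock `c` rings in configuration `σ`. -/
def ringLaw (A : Parameters) (G : Payoffs) (σ : Config m K) : Clock K → PMF (Config m K)
  | .move i => moveLaw σ i
  | .game p => gameLaw G σ p.1.1 p.1.2
  | .birth i => birthLaw A σ i

/-! ### The continuous time Markov chain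

The clocks are independent Poisson processes, of rate `d` for the movements, `v` for the games and
`b` for the births. Their superposition is a Poisson process of rate `totalRate`, each ring of which
belongs to a given clock with a probability proportional to the rate of this clock, independently of
everything else. So the process is the continuous time Markov chain which, in configuration `σ`,
jumps with rate `rate c` to a configuration of law `ringLaw σ c`, for every clock `c`; it is
constructed from its jump chain and its exponential holding times. -/

def rate (A : Parameters) : Clock K → ℝ≥0
  | .move _ => A.d
  | .game _ => A.v
  | .birth _ => A.b

variable (K) in
def totalRate (A : Parameters) : ℝ≥0 := ∑ c : Clock K, rate A c

theorem totalRate_pos [NeZero K] (A : Parameters) : 0 < totalRate K A :=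
  lt_of_lt_of_le A.d_pos
    (Finset.single_le_sum (f := rate A) (fun _ _ => zero_le) (Finset.mem_univ (Clock.move 0)))

variable (K) in
/-- The law of the clock that rings next. -/
def clockLaw [NeZero K] (A : Parameters) : PMF (Clock K) :=
  PMF.ofFintype (fun c => ((rate A c / totalRate K A : ℝ≥0) : ℝ≥0∞)) (by
    rw [← ENNReal.ofNNReal_finsetSum, ← Finset.sum_div]
    exact_mod_cast div_self (totalRate_pos (K := K) A).ne')

/-- The law of the configuration after the next ring, from configuration `σ`. -/
def stepLaw [NeZero K] (A : Parameters) (G : Payoffs) (σ : Config m K) : PMF (Config m K) :=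
  (clockLaw K A).bind (ringLaw A G σ)

/-- The transition kernel of the jump chain. -/
def stepKernel [NeZero K] (A : Parameters) (G : Payoffs) : Kernel (Config m K) (Config m K) where
  toFun σ := (stepLaw A G σ).toMeasure
  measurable' := measurable_from_top

instance [NeZero K] (A : Parameters) (G : Payoffs) :
    IsMarkovKernel (stepKernel (m := m) (K := K) A G) :=
  ⟨fun σ => (inferInstance : IsProbabilityMeasure (stepLaw A G σ).toMeasure)⟩

instance [NeZero K] (A : Parameters) :
    IsProbabilityMeasure (expMeasure (totalRate K A : ℝ)) :=
  isProbabilityMeasure_expMeasure (NNReal.coe_pos.2 (totalRate_pos A))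

/-- The law of the jump chain started at `σ`. -/
def chainLaw [NeZero K] (A : Parameters) (G : Payoffs) (σ : Config m K) :
    Measure (ℕ → Config m K) :=
  Kernel.trajMeasure (X := fun _ => Config m K) (Measure.dirac σ)
    (fun n => (stepKernel A G).comap
      (fun x : (i : Finset.Iic n) → Config m K => x ⟨n, Finset.mem_Iic.2 le_rfl⟩)
      (measurable_pi_apply _))

variable (K) in
/-- The law of the sequence of times between successive rings: independent exponential variables of
parameter `totalRate`. -/
def waitLaw [NeZero K] (A : Parameters) : Measure (ℕ → ℝ) :=
  Measure.infinitePi (fun _ : ℕ => expMeasure (totalRate K A : ℝ))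

/-- The probability `ℙ_σ`, on pairs made of a trajectory of the jump chain and an independent
sequence of waiting times. -/
def processLaw [NeZero K] (A : Parameters) (G : Payoffs) (σ : Config m K) :
    Measure ((ℕ → Config m K) × (ℕ → ℝ)) :=
  (chainLaw A G σ).prod (waitLaw K A)

/-- The configuration `σ_t` at time `t`: it is the `n`-th state of the jump chain, where
`Δ₀ + ⋯ + Δₙ₋₁ ≤ t < Δ₀ + ⋯ + Δₙ` and `Δ₀, Δ₁, …` are the waiting times. -/
def configAt (t : ℝ) (ω : (ℕ → Config m K) × (ℕ → ℝ)) : Config m K :=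
  ω.1 (sInf {n : ℕ | t < ∑ k ∈ Finset.range (n + 1), ω.2 k})

end

end dynamics

end DemographicPD

/-!
The wealth `W` of all cooperators together, dead ones included, changes only through games: births
merely redistribute it. It is bounded below along every trajectory, since a cooperator with
nonpositive wealth never plays again and a living one loses at most `S` in a game. A ring increases
`W` by at most `2 R`, and only while some cooperator lives.

A living defector survives forever: a defector gains `T` from a cooperator, and in a game between
two defectors one of the two players loses nothing. The positions being on a finite torus, a living
cooperator and a living defector can be brought to the same site by at most `2 m - 2` prescribed
moves, and their game clock may ring next; then `W` drops by `S`. So while cooperators live, each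
window of `2 m` rings holds a meeting on one site with probability at least `δ = (d / 4 Λ) ^ (2 m)`,
where `Λ` is the total rate (`shiftProb_pow_mul_probAt_le_sum`), and each meeting costs the
cooperators `S v / Λ` in expectation (`mean_energy_stepLaw_le`). If `S (v / Λ) δ > 2 R * 2 m`, the
losses outweigh the gains, and as `W` is bounded below, the sum over `n` of the probabilities that a
cooperator lives after `n` rings is finite (`sum_le_of_drift`,
`tsum_probAt_livingCooperatorSet_ne_top`). By the first Borel-Cantelli lemma the jump chain almost
surely has no living cooperator from some rank on. Only the marginal laws of the chain enter
(`map_eval_chainLaw`).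

The waiting times almost surely have an infinite sum (`ae_waitLaw_sum_unbounded`), so a property
that holds from some rank on holds from some time on (`exists_time_of_eventually`).
-/

namespace DemographicPD

/-! ### Averages against discrete laws -/

section mean

variable {α β : Type*}

/-- The expectation of a function with values in `[0, ∞]` under a discrete law, as a sum. -/
noncomputable def mean (p : PMF α) (f : α → ℝ≥0∞) : ℝ≥0∞ := ∑' a, p a * f a

lemma mean_pure (a : α) (f : α → ℝ≥0∞) : mean (PMF.pure a) f = f a := by
  rw [mean, tsum_eq_single a]
  · simp
  · intro b hb
    simp [hb]

lemma mean_bind (p : PMF α) (k : α → PMF β) (f : β → ℝ≥0∞) :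
    mean (p.bind k) f = mean p (fun a => mean (k a) f) := by
  simp only [mean, PMF.bind_apply, ← ENNReal.tsum_mul_right, ← ENNReal.tsum_mul_left]
  rw [ENNReal.tsum_comm]
  simp only [mul_assoc]

lemma mean_map (p : PMF α) (g : α → β) (f : β → ℝ≥0∞) :
    mean (p.map g) f = mean p (f ∘ g) := by
  rw [← PMF.bind_pure_comp, mean_bind]
  simp [mean_pure, Function.comp_def]

lemma mean_mono {p : PMF α} {f g : α → ℝ≥0∞} (h : ∀ a ∈ p.support, f a ≤ g a) :
    mean p f ≤ mean p g := by
  refine ENNReal.tsum_le_tsum fun a => ?_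
  by_cases ha : a ∈ p.support
  · exact mul_le_mul_right (h a ha) _
  · simp [(p.apply_eq_zero_iff a).2 ha]

lemma mean_const (p : PMF α) (B : ℝ≥0∞) : mean p (fun _ => B) = B := by
  rw [mean, ENNReal.tsum_mul_right, p.tsum_coe, one_mul]

lemma mean_add (p : PMF α) (f g : α → ℝ≥0∞) :
    mean p (fun a => f a + g a) = mean p f + mean p g := by
  simp only [mean, mul_add, ENNReal.tsum_add]

lemma mean_const_mul (p : PMF α) (B : ℝ≥0∞) (f : α → ℝ≥0∞) :
    mean p (fun a => B * f a) = B * mean p f := by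
  simp only [mean, ← ENNReal.tsum_mul_left, mul_left_comm]

lemma mean_finset_sum {ι : Type*} (p : PMF α) (s : Finset ι) (f : ι → α → ℝ≥0∞) :
    mean p (fun a => ∑ i ∈ s, f i a) = ∑ i ∈ s, mean p (f i) := by
  simp only [mean, Finset.mul_sum]
  exact Summable.tsum_finsetSum fun _ _ => ENNReal.summable

lemma apply_mul_le_mean (p : PMF α) (f : α → ℝ≥0∞) (a : α) : p a * f a ≤ mean p f :=
  ENNReal.le_tsum a

lemma mean_indicator (p : PMF α) (s : Set α) :
    mean p (s.indicator 1) = p.toOuterMeasure s := by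
  rw [PMF.toOuterMeasure_apply, mean]
  refine tsum_congr fun a => ?_
  by_cases h : a ∈ s <;> simp [h]

lemma lintegral_toMeasure [MeasurableSpace α] [DiscreteMeasurableSpace α] (p : PMF α)
    (f : α → ℝ≥0∞) : ∫⁻ a, f a ∂p.toMeasure = mean p f := by
  rw [← p.restrict_toMeasure_support, lintegral_countable _ p.support_countable, mean]
  have : ∀ a, p.toMeasure {a} = p a := fun a =>
    p.toMeasure_apply_singleton a (MeasurableSet.singleton a)
  simp only [this]
  rw [tsum_subtype p.support (fun a => f a * p a)]
  refine tsum_congr fun a => ?_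
  by_cases h : a ∈ p.support
  · simp [h, mul_comm]
  · rw [Set.indicator_of_notMem h, (p.apply_eq_zero_iff a).2 h, zero_mul]

end mean

/-! ### Marginal laws of the jump chain -/

section chain

variable {m K : ℕ} [NeZero K]

instance : DiscreteMeasurableSpace (Config m K) := ⟨fun _ => trivial⟩

/-- The law of the `n`-th configuration of the jump chain, as a discrete law. -/
noncomputable def marginal (A : Parameters) (G : Payoffs) (σ : Config m K) : ℕ → PMF (Config m K)
  | 0 => PMF.pure σ
  | n + 1 => (marginal A G σ n).bind (stepLaw A G)

instance (A : Parameters) (G : Payoffs) (σ : Config m K) :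
    IsProbabilityMeasure (chainLaw A G σ) := by
  unfold chainLaw
  infer_instance

lemma map_eval_zero_chainLaw (A : Parameters) (G : Payoffs) (σ : Config m K) :
    (chainLaw A G σ).map (fun ω => ω 0) = Measure.dirac σ := by
  have h : (fun ω : ℕ → Config m K => ω 0) =
      (fun x : (i : Finset.Iic 0) → Config m K => x ⟨0, Finset.mem_Iic.2 le_rfl⟩) ∘
        Preorder.frestrictLe 0 := rfl
  rw [h, ← Measure.map_map (measurable_pi_apply _) (by fun_prop), chainLaw, Kernel.trajMeasure,
    Measure.map_comp _ _ (by fun_prop), Kernel.traj_map_frestrictLe, Kernel.partialTraj_self,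
    Measure.id_comp, Measure.map_map (measurable_pi_apply _) (by fun_prop)]
  exact Measure.map_id

lemma map_eval_succ_chainLaw (A : Parameters) (G : Payoffs) (σ : Config m K) (n : ℕ)
    (s : Set (Config m K)) :
    (chainLaw A G σ).map (fun ω => ω (n + 1)) s =
      ∫⁻ x, stepKernel A G x s ∂(chainLaw A G σ).map (fun ω => ω n) := by
  have key := Kernel.map_frestrictLe_trajMeasure_compProd_eq_map_trajMeasure
    (X := fun _ => Config m K) (μ₀ := Measure.dirac σ)
    (κ := fun n => (stepKernel A G).comap
      (fun x : (i : Finset.Iic n) → Config m K => x ⟨n, Finset.mem_Iic.2 le_rfl⟩)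
      (measurable_pi_apply _)) (a := n)
  have hs : MeasurableSet s := trivial
  have h : (chainLaw A G σ).map (fun ω => ω (n + 1)) =
      ((chainLaw A G σ).map (fun ω => (Preorder.frestrictLe n ω, ω (n + 1)))).map Prod.snd := by
    rw [Measure.map_map measurable_snd (by fun_prop)]
    rfl
  rw [h, Measure.map_apply measurable_snd hs, chainLaw, ← key,
    Measure.compProd_apply (measurable_snd hs), lintegral_map _ (by fun_prop),
    lintegral_map measurable_from_top (measurable_pi_apply _)]
  · rfl
  · exact Kernel.measurable_kernel_prodMk_left (measurable_snd hs)

lemma map_eval_chainLaw (A : Parameters) (G : Payoffs) (σ : Config m K) (n : ℕ) :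
    (chainLaw A G σ).map (fun ω => ω n) = (marginal A G σ n).toMeasure := by
  induction n with
  | zero => rw [map_eval_zero_chainLaw, marginal, PMF.toMeasure_pure]
  | succ n ih =>
    ext s hs
    rw [map_eval_succ_chainLaw, ih, lintegral_toMeasure, marginal, PMF.toMeasure_bind_apply _ _ _ hs]
    rfl

end chain

/-! ### Effect of one ring on the living individuals and on the wealth of the cooperators -/

section configurations

variable {m K : ℕ}

/-- The total wealth of all cooperators, dead ones included with their (nonpositive) wealth at
death: keeping the dead makes the sum change only through games. -/
noncomputable def coopWealth (σ : Config m K) : ℝ :=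
  ∑ k, if (σ k).role = Role.cooperator then (σ k).wealth else 0

/-- Some cooperator has positive wealth. -/
def livingCooperatorSet (m K : ℕ) : Set (Config m K) :=
  {σ | ∃ i, IsLivingCooperator σ i}

/-- The configurations with a living defector, in which no cooperator has a debt larger than `c`. -/
def admissible (m K : ℕ) (c : ℝ) : Set (Config m K) :=
  {σ | (∃ i, IsLivingDefector σ i) ∧
    ∀ i, (σ i).role = Role.cooperator → -c ≤ (σ i).wealth}

/-- Some living cooperator can reach some living defector in exactly `r` steps, all of them to the
right or upwards: coordinates of the displacement are represented in `{0, …, m - 1}`. -/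
def near (m K r : ℕ) : Set (Config m K) :=
  {σ | ∃ i j, IsLivingCooperator σ i ∧ IsLivingDefector σ j ∧
    ((σ j).pos - (σ i).pos).1.val + ((σ j).pos - (σ i).pos).2.val = r}

lemma coopWealth_shift (σ : Config m K) (i : Fin K) (e : Direction) :
    coopWealth (shift σ i e) = coopWealth σ := by
  refine Finset.sum_congr rfl fun k _ => ?_
  by_cases h : k = i <;> simp [shift, h]

lemma coopWealth_addWealth (σ : Config m K) {i j : Fin K} (hij : i ≠ j) (u : ℝ × ℝ) :
    coopWealth (addWealth σ i j u) = coopWealth σ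
      + (if (σ i).role = Role.cooperator then u.1 else 0)
      + (if (σ j).role = Role.cooperator then u.2 else 0) := by
  have h : ∀ k, (if (addWealth σ i j u k).role = Role.cooperator
        then (addWealth σ i j u k).wealth else 0) =
      (if (σ k).role = Role.cooperator then (σ k).wealth else 0)
      + (if k = i then (if (σ i).role = Role.cooperator then u.1 else 0) else 0)
      + (if k = j then (if (σ j).role = Role.cooperator then u.2 else 0) else 0) := by
    intro k
    by_cases hi : k = i
    · subst hi
      by_cases hc : (σ k).role = Role.cooperator <;> simp [addWealth, hij, hc]
    · by_cases hj : k = j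
      · subst hj
        by_cases hc : (σ k).role = Role.cooperator <;> simp [addWealth, hi, hc]
      · simp [addWealth, hi, hj]
  simp only [coopWealth, h, Finset.sum_add_distrib, Finset.sum_ite_eq', Finset.mem_univ, if_true]

lemma coopWealth_addChild (w₀ : ℝ) (σ : Config m K) {i j : Fin K}
    (hi : (σ i).role ≠ Role.unborn) (hj : (σ j).role = Role.unborn) :
    coopWealth (addChild w₀ σ i j) = coopWealth σ := by
  have hij : i ≠ j := fun h => hi (h ▸ hj)
  have h : ∀ k, (if (addChild w₀ σ i j k).role = Role.cooperator
        then (addChild w₀ σ i j k).wealth else 0) =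
      (if (σ k).role = Role.cooperator then (σ k).wealth else 0)
      + (if k = i then (if (σ i).role = Role.cooperator then -w₀ else 0) else 0)
      + (if k = j then (if (σ i).role = Role.cooperator then w₀ else 0) else 0) := by
    intro k
    by_cases hk : k = i
    · subst hk
      by_cases hc : (σ k).role = Role.cooperator <;> simp [addChild, hij, hc, sub_eq_add_neg]
    · by_cases hkj : k = j
      · subst hkj
        by_cases hc : (σ i).role = Role.cooperator <;> simp [addChild, hk, hc, hj]
      · simp [addChild, hk, hkj]
  simp only [coopWealth, h, Finset.sum_add_distrib, Finset.sum_ite_eq', Finset.mem_univ, if_true]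
  split_ifs <;> ring

/-- Two defectors never kill each other: one of the two players always loses nothing. -/
lemma mem_support_payoffLaw {G : Payoffs} {a b : Role} (ha : a ≠ Role.unborn)
    (hb : b ≠ Role.unborn) {u : ℝ × ℝ} (hu : u ∈ (payoffLaw G a b).support) :
    (a = Role.cooperator ∧ b = Role.cooperator ∧ u = (G.R, G.R)) ∨
    (a = Role.cooperator ∧ b = Role.defector ∧ u = (-G.S, G.T)) ∨
    (a = Role.defector ∧ b = Role.cooperator ∧ u = (G.T, -G.S)) ∨
    (a = Role.defector ∧ b = Role.defector ∧ (0 ≤ u.1 ∨ 0 ≤ u.2)) := by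
  cases a <;> cases b <;> simp_all [payoffLaw]
  rcases hu with h | h <;> simp [← h]

lemma mem_support_moveLaw {σ τ : Config m K} {i : Fin K} (h : τ ∈ (moveLaw σ i).support) :
    ∃ e, τ = shift σ i e := by
  obtain ⟨e, -, rfl⟩ := (PMF.mem_support_map_iff _ _ _).1 h
  exact ⟨e, rfl⟩

lemma mem_support_gameLaw {G : Payoffs} {σ τ : Config m K} {i j : Fin K}
    (h : τ ∈ (gameLaw G σ i j).support) :
    (τ = σ ∧ ¬(IsAlive σ i ∧ IsAlive σ j ∧ (σ i).pos = (σ j).pos)) ∨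
    (IsAlive σ i ∧ IsAlive σ j ∧
      ∃ u ∈ (payoffLaw G (σ i).role (σ j).role).support, τ = addWealth σ i j u) := by
  unfold gameLaw at h
  split_ifs at h with hc
  · obtain ⟨u, hu, rfl⟩ := (PMF.mem_support_map_iff _ _ _).1 h
    exact Or.inr ⟨hc.1, hc.2.1, u, hu, rfl⟩
  · exact Or.inl ⟨(PMF.mem_support_pure_iff _ _).1 h, hc⟩

lemma mem_support_birthLaw {A : Parameters} {σ τ : Config m K} {i : Fin K}
    (h : τ ∈ (birthLaw A σ i).support) :
    τ = σ ∨ ((σ i).role ≠ Role.unborn ∧ A.wc < (σ i).wealth ∧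
      ∃ j, (σ j).role = Role.unborn ∧ τ = addChild A.w₀ σ i j) := by
  unfold birthLaw at h
  split_ifs at h with hc
  · obtain ⟨j, hj, rfl⟩ := (PMF.mem_support_map_iff _ _ _).1 h
    rw [PMF.mem_support_uniformOfFinset_iff] at hj
    exact Or.inr ⟨hc.1, hc.2.1, j, (Finset.mem_filter.1 hj).2, rfl⟩
  · exact Or.inl ((PMF.mem_support_pure_iff _ _).1 h)

lemma coopWealth_le_of_ring {A : Parameters} {G : Payoffs} {σ τ : Config m K} {k : Clock K}
    (h : τ ∈ (ringLaw A G σ k).support) :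
    coopWealth τ ≤ coopWealth σ + 2 * G.R * (livingCooperatorSet m K).indicator 1 σ := by
  have hR := G.R_pos
  have hS := G.P_pos.trans G.P_lt_S
  have h0 : (0 : ℝ) ≤ 2 * G.R * (livingCooperatorSet m K).indicator 1 σ :=
    mul_nonneg (by linarith) (Set.indicator_nonneg (fun _ _ => zero_le_one) _)
  match k with
  | .move i =>
    obtain ⟨e, rfl⟩ := mem_support_moveLaw h
    rw [coopWealth_shift]
    linarith
  | .birth i =>
    rcases mem_support_birthLaw h with rfl | ⟨hi, -, j, hj, rfl⟩
    · linarith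
    · rw [coopWealth_addChild _ _ hi hj]
      linarith
  | .game p =>
    rcases mem_support_gameLaw h with ⟨rfl, -⟩ | ⟨hi, hj, u, hu, rfl⟩
    · linarith
    rw [coopWealth_addWealth _ p.2.ne]
    rcases mem_support_payoffLaw hi.1 hj.1 hu with ⟨ha, hb, rfl⟩ | ⟨ha, hb, rfl⟩ | ⟨ha, hb, rfl⟩ |
      ⟨ha, hb, -⟩
    · have : σ ∈ livingCooperatorSet m K := ⟨_, ha, hi.2⟩
      simp [ha, hb, this]
      linarith
    all_goals
      simp only [ha, hb, if_true, reduceCtorEq, if_false]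
      linarith

lemma coopWealth_of_exploitation {G : Payoffs} {σ τ : Config m K} {i j : Fin K} (hij : i ≠ j)
    (hi : IsAlive σ i) (hj : IsAlive σ j) (hpos : (σ i).pos = (σ j).pos)
    (hrole : (σ i).role = Role.cooperator ∧ (σ j).role = Role.defector ∨
      (σ i).role = Role.defector ∧ (σ j).role = Role.cooperator)
    (h : τ ∈ (gameLaw G σ i j).support) : coopWealth τ = coopWealth σ - G.S := by
  rcases mem_support_gameLaw h with ⟨-, hn⟩ | ⟨-, -, u, hu, rfl⟩
  · exact absurd ⟨hi, hj, hpos⟩ hn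
  rw [coopWealth_addWealth _ hij]
  rcases hrole with ⟨ha, hb⟩ | ⟨ha, hb⟩ <;>
    simp_all [payoffLaw, sub_eq_add_neg]

lemma admissible_of_ring {A : Parameters} {G : Payoffs} {c : ℝ} (hc : G.S ≤ c)
    {σ τ : Config m K} {k : Clock K} (hσ : σ ∈ admissible m K c)
    (h : τ ∈ (ringLaw A G σ k).support) : τ ∈ admissible m K c := by
  obtain ⟨⟨d, hd, hdw⟩, hco⟩ := hσ
  have hR := G.R_pos
  have hT := G.R_lt_T
  have hS := G.P_pos.trans G.P_lt_S
  have hw := A.w₀_pos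
  have hwc := A.w₀_lt_wc
  match k with
  | .move i =>
    obtain ⟨e, rfl⟩ := mem_support_moveLaw h
    have h1 : ∀ k, (shift σ i e k).role = (σ k).role ∧ (shift σ i e k).wealth = (σ k).wealth := by
      intro k
      by_cases hk : k = i <;> simp [shift, hk]
    refine ⟨⟨d, (h1 d).1.trans hd, by rw [(h1 d).2]; exact hdw⟩, fun k hk => ?_⟩
    rw [(h1 k).2]
    exact hco k ((h1 k).1.symm.trans hk)
  | .birth i =>
    rcases mem_support_birthLaw h with rfl | ⟨hi, hiw, j, hj, rfl⟩
    · exact ⟨⟨d, hd, hdw⟩, hco⟩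
    refine ⟨⟨d, ?_⟩, fun k hk => ?_⟩
    · have hdj : d ≠ j := fun h => by simp [h, hj] at hd
      by_cases hdi : d = i
      · subst hdi
        exact ⟨by simp [addChild, hdj, hd], by simp [addChild, hdj]; linarith⟩
      · exact ⟨by simp [addChild, hdj, hdi, hd], by simpa [addChild, hdj, hdi] using hdw⟩
    · by_cases hkj : k = j
      · simp [addChild, hkj]
        linarith
      · by_cases hki : k = i
        · subst hki
          simp [addChild, hkj]
          linarith
        · simp only [addChild, hkj, hki, if_false] at hk ⊢
          exact hco k hk
  | .game p =>
    rcases mem_support_gameLaw h with ⟨rfl, -⟩ | ⟨hi, hj, u, hu, rfl⟩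
    · exact ⟨⟨d, hd, hdw⟩, hco⟩
    obtain ⟨⟨i, j⟩, hlt⟩ := p
    have hij : i ≠ j := hlt.ne
    simp only at hi hj hu ⊢
    have hrole : ∀ k, (addWealth σ i j u k).role = (σ k).role := by
      intro k
      simp only [addWealth]
      split_ifs <;> rfl
    have hwi : (addWealth σ i j u i).wealth = (σ i).wealth + u.1 := by simp [addWealth]
    have hwj : (addWealth σ i j u j).wealth = (σ j).wealth + u.2 := by simp [addWealth, hij.symm]
    have hwk : ∀ k, k ≠ i → k ≠ j → (addWealth σ i j u k).wealth = (σ k).wealth := by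
      intro k h1 h2
      simp [addWealth, h1, h2]
    have hiw := hi.2
    have hjw := hj.2
    have hpay := mem_support_payoffLaw hi.1 hj.1 hu
    constructor
    · -- The defector `d` may die in this game, but then its opponent is a surviving defector.
      simp only [IsLivingDefector, hrole]
      by_cases hdi : d = i
      · rw [hdi] at hd
        rcases hpay with ⟨ha, -⟩ | ⟨ha, -⟩ | ⟨ha, hb, rfl⟩ | ⟨ha, hb, h1 | h1⟩
        · simp [ha] at hd
        · simp [ha] at hd
        · exact ⟨i, ha, by rw [hwi]; linarith⟩
        · exact ⟨i, ha, by rw [hwi]; linarith⟩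
        · exact ⟨j, hb, by rw [hwj]; linarith⟩
      · by_cases hdj : d = j
        · rw [hdj] at hd
          rcases hpay with ⟨-, hb, -⟩ | ⟨ha, hb, rfl⟩ | ⟨-, hb, -⟩ | ⟨ha, hb, h1 | h1⟩
          · simp [hb] at hd
          · exact ⟨j, hb, by rw [hwj]; linarith⟩
          · simp [hb] at hd
          · exact ⟨i, ha, by rw [hwi]; linarith⟩
          · exact ⟨j, hb, by rw [hwj]; linarith⟩
        · exact ⟨d, hd, by rw [hwk d hdi hdj]; exact hdw⟩
    · intro k hk
      rw [hrole] at hk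
      by_cases hki : k = i
      · rw [hki] at hk ⊢
        rw [hwi]
        rcases hpay with ⟨-, -, rfl⟩ | ⟨-, -, rfl⟩ | ⟨ha, -⟩ | ⟨ha, -⟩
        · linarith
        · linarith
        · simp [ha] at hk
        · simp [ha] at hk
      · by_cases hkj : k = j
        · rw [hkj] at hk ⊢
          rw [hwj]
          rcases hpay with ⟨-, -, rfl⟩ | ⟨-, hb, -⟩ | ⟨-, -, rfl⟩ | ⟨-, hb, -⟩
          · linarith
          · simp [hb] at hk
          · linarith
          · simp [hb] at hk
        · rw [hwk k hki hkj]
          exact hco k hk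

lemma coopWealth_ge {c : ℝ} (hc : 0 ≤ c) {σ : Config m K} (hσ : σ ∈ admissible m K c) :
    0 ≤ coopWealth σ + K * c := by
  have : ∑ _k : Fin K, (-c) ≤ coopWealth σ := by
    refine Finset.sum_le_sum fun k _ => ?_
    split_ifs with h
    · exact hσ.2 k h
    · linarith
  simp at this
  linarith

lemma val_sub_one_of_val_eq_succ [NeZero m] {a : ZMod m} {s : ℕ} (h : a.val = s + 1) :
    (a - 1).val = s := by
  have hm : m ≠ 1 := by
    rintro rfl
    have := ZMod.val_lt a
    omega
  have h1 : (1 : ZMod m).val = 1 := ZMod.val_one'' hm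
  rw [ZMod.val_sub (by omega), h, h1, Nat.add_sub_cancel]

lemma exists_shift_mem_near [NeZero m] {r : ℕ} {σ : Config m K} (h : σ ∈ near m K (r + 1)) :
    ∃ i e, shift σ i e ∈ near m K r := by
  obtain ⟨i, j, hi, hj, hr⟩ := h
  have hji : j ≠ i := by
    rintro rfl
    simpa using hi.1.symm.trans hj.1
  have hs : ∀ e, IsLivingCooperator (shift σ i e) i ∧ IsLivingDefector (shift σ i e) j ∧
      (shift σ i e j).pos - (shift σ i e i).pos = (σ j).pos - (σ i).pos - e.vec m := by
    intro e
    refine ⟨?_, ?_, ?_⟩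
    · simpa [IsLivingCooperator, shift] using hi
    · simpa [IsLivingDefector, shift, hji] using hj
    · simp [shift, hji, sub_sub]
  rcases Nat.eq_zero_or_eq_succ_pred ((σ j).pos - (σ i).pos).1.val with h0 | h0
  · refine ⟨i, .top, i, j, (hs _).1, (hs _).2.1, ?_⟩
    rw [h0, zero_add] at hr
    rw [(hs _).2.2, Prod.fst_sub, Prod.snd_sub _ (Direction.vec m _)]
    simp only [Direction.vec, sub_zero]
    rw [h0, val_sub_one_of_val_eq_succ hr, zero_add]
  · refine ⟨i, .right, i, j, (hs _).1, (hs _).2.1, ?_⟩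
    rw [(hs _).2.2, Prod.fst_sub _ (Direction.vec m _), Prod.snd_sub _ (Direction.vec m _)]
    simp only [Direction.vec, sub_zero]
    rw [val_sub_one_of_val_eq_succ h0]
    omega

lemma exists_mem_near [NeZero m] {c : ℝ} {σ : Config m K} (hσ : σ ∈ admissible m K c)
    (hc : σ ∈ livingCooperatorSet m K) : ∃ r < 2 * m, σ ∈ near m K r := by
  obtain ⟨i, hi⟩ := hc
  obtain ⟨⟨j, hj⟩, -⟩ := hσ
  have h1 := ZMod.val_lt ((σ j).pos - (σ i).pos).1
  have h2 := ZMod.val_lt ((σ j).pos - (σ i).pos).2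
  exact ⟨_, by omega, i, j, hi, hj, rfl⟩

end configurations

/-! ### Real time: the waiting times have an infinite sum -/

section time

lemma ae_expMeasure_nonneg {r : ℝ} (hr : 0 < r) : ∀ᵐ x ∂expMeasure r, 0 ≤ x := by
  have := isProbabilityMeasure_expMeasure hr
  have h : expMeasure r (Set.Iic 0) = 0 := by
    rw [← ofReal_cdf, cdf_expMeasure_eq hr]
    simp
  filter_upwards [measure_eq_zero_iff_ae_notMem.1 h] with x hx
  exact (not_le.1 hx).le

lemma expMeasure_Ioi_one_ne_zero {r : ℝ} (hr : 0 < r) : expMeasure r (Set.Ioi 1) ≠ 0 := by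
  have := isProbabilityMeasure_expMeasure hr
  rw [← Set.compl_Iic, prob_compl_eq_one_sub measurableSet_Iic, ← ofReal_cdf,
    cdf_expMeasure_eq hr, if_pos zero_le_one, mul_one]
  refine (tsub_pos_of_lt ?_).ne'
  rw [ENNReal.ofReal_lt_one]
  linarith [Real.exp_pos (-r)]

instance (K : ℕ) [NeZero K] (A : Parameters) : IsProbabilityMeasure (waitLaw K A) := by
  unfold waitLaw
  infer_instance

/-- The chain does not explode: infinitely many waiting times are larger than `1`, by the second
Borel-Cantelli lemma. -/
lemma ae_waitLaw_sum_unbounded (K : ℕ) [NeZero K] (A : Parameters) :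
    ∀ᵐ δ ∂waitLaw K A, ∀ t : ℝ, ∃ n, t < ∑ k ∈ Finset.range (n + 1), δ k := by
  have hr : (0 : ℝ) < totalRate K A := NNReal.coe_pos.2 (totalRate_pos A)
  have heval : ∀ n, MeasurePreserving (fun δ : ℕ → ℝ => δ n) (waitLaw K A)
      (expMeasure (totalRate K A : ℝ)) := fun n =>
    measurePreserving_eval_infinitePi (fun _ : ℕ => expMeasure (totalRate K A : ℝ)) n
  have hnonneg : ∀ᵐ δ ∂waitLaw K A, ∀ n, 0 ≤ δ n :=
    ae_all_iff.2 fun n => (heval n).quasiMeasurePreserving.ae (ae_expMeasure_nonneg hr)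
  have hind : iIndepFun (fun (n : ℕ) (δ : ℕ → ℝ) => δ n) (waitLaw K A) :=
    iIndepFun_infinitePi (P := fun _ : ℕ => expMeasure (totalRate K A : ℝ))
      (X := fun _ x => x) (fun _ => measurable_id)
  have hm : ∀ n : ℕ, MeasurableSet {δ : ℕ → ℝ | δ n ∈ Set.Ioi 1} := fun n =>
    measurable_pi_apply n measurableSet_Ioi
  have hset : iIndepSet (fun n : ℕ => {δ : ℕ → ℝ | δ n ∈ Set.Ioi 1}) (waitLaw K A) := by
    rw [iIndepSet_iff_meas_biInter hm]
    intro s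
    exact hind.measure_inter_preimage_eq_mul s fun _ _ => measurableSet_Ioi
  have hsum : ∑' n : ℕ, waitLaw K A {δ : ℕ → ℝ | δ n ∈ Set.Ioi 1} = ∞ := by
    have h1 : ∀ n : ℕ, waitLaw K A {δ : ℕ → ℝ | δ n ∈ Set.Ioi 1} =
        expMeasure (totalRate K A : ℝ) (Set.Ioi 1) := fun n =>
      (heval n).measure_preimage measurableSet_Ioi.nullMeasurableSet
    simp only [h1]
    exact ENNReal.tsum_const_eq_top_of_ne_zero (expMeasure_Ioi_one_ne_zero hr)
  have hlim := measure_limsup_eq_one hm hset hsum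
  have hfreq : ∀ᵐ δ ∂waitLaw K A,
      δ ∈ limsup (fun n : ℕ => {δ : ℕ → ℝ | δ n ∈ Set.Ioi 1}) atTop :=
    (mem_ae_iff_prob_eq_one (MeasurableSet.measurableSet_limsup hm)).2 hlim
  filter_upwards [hnonneg, hfreq] with δ h0 hf t
  by_contra! hcon
  have hs : Summable δ := by
    refine summable_of_sum_range_le h0 (c := t) fun n => le_trans ?_ (hcon n)
    exact Finset.sum_le_sum_of_subset_of_nonneg (Finset.range_mono n.le_succ) fun k _ _ => h0 k
  rw [mem_limsup_iff_frequently_mem] at hf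
  obtain ⟨n, h1, h2⟩ := (hf.and_eventually
    (hs.tendsto_atTop_zero.eventually (gt_mem_nhds zero_lt_one))).exists
  exact absurd h2 (not_lt.2 (le_of_lt h1))

/-- If the jump times tend to infinity, then a property that the jump chain has from some rank on
holds from some time on. -/
lemma exists_time_of_eventually {m K : ℕ} {ω : (ℕ → Config m K) × (ℕ → ℝ)}
    (hω : ∀ t : ℝ, ∃ n, t < ∑ k ∈ Finset.range (n + 1), ω.2 k) {p : Config m K → Prop}
    (hp : ∀ᶠ n in atTop, p (ω.1 n)) : ∃ t₀ : ℝ, 0 ≤ t₀ ∧ ∀ t, t₀ ≤ t → p (configAt t ω) := by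
  obtain ⟨N, hN⟩ := eventually_atTop.1 hp
  have hpos : ∀ n, 0 ≤ |∑ k ∈ Finset.range (n + 1), ω.2 k| := fun n => abs_nonneg _
  refine ⟨∑ n ∈ Finset.range N, |∑ k ∈ Finset.range (n + 1), ω.2 k|,
    Finset.sum_nonneg fun n _ => hpos n, fun t ht => hN _ ?_⟩
  -- The set in the definition of `configAt` is nonempty, so its infimum is attained.
  have hmem : t < _ := Nat.sInf_mem (s := {n : ℕ | t < ∑ k ∈ Finset.range (n + 1), ω.2 k}) (hω t)
  by_contra! hlt
  have h1 := Finset.single_le_sum (f := fun n => |∑ k ∈ Finset.range (n + 1), ω.2 k|)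
    (fun n _ => hpos n) (Finset.mem_range.2 hlt)
  have h2 := le_abs_self (∑ k ∈ Finset.range
    (sInf {n : ℕ | t < ∑ k ∈ Finset.range (n + 1), ω.2 k} + 1), ω.2 k)
  linarith

end time

/-! ### Drift of the wealth of the cooperators along the jump chain -/

section drift

variable {m K : ℕ}

/-- The total wealth of the cooperators, shifted by `K * c` in order to be nonnegative on admissible
configurations. -/
noncomputable def energy (c : ℝ) (σ : Config m K) : ℝ≥0∞ :=
  ENNReal.ofReal (coopWealth σ + K * c)

/-- A living cooperator and a living defector on the same site: the game clock of this pair makes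
the cooperators lose `S`. -/
lemma exists_game_energy_add_le [NeZero m] (A : Parameters) (G : Payoffs) {c : ℝ} (hc : G.S ≤ c)
    {σ : Config m K} (hσ : σ ∈ admissible m K c) (h0 : σ ∈ near m K 0) :
    ∃ p, ∀ τ ∈ (ringLaw A G σ (.game p)).support,
      energy c τ + ENNReal.ofReal G.S ≤ energy c σ := by
  obtain ⟨i, j, hi, hj, hr⟩ := h0
  have hS := G.P_pos.trans G.P_lt_S
  have hpos : (σ i).pos = (σ j).pos := by
    have h1 := (ZMod.val_eq_zero _).1 (Nat.eq_zero_of_add_eq_zero_right hr)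
    have h2 := (ZMod.val_eq_zero _).1 (Nat.eq_zero_of_add_eq_zero_left hr)
    exact (sub_eq_zero.1 (Prod.ext h1 h2)).symm
  have hia : IsAlive σ i := ⟨by simp [hi.1], hi.2⟩
  have hja : IsAlive σ j := ⟨by simp [hj.1], hj.2⟩
  have hij : i ≠ j := by
    rintro rfl
    simpa using hi.1.symm.trans hj.1
  have key : ∀ p, (∀ τ ∈ (ringLaw A G σ (.game p)).support, coopWealth τ = coopWealth σ - G.S) →
      ∀ τ ∈ (ringLaw A G σ (.game p)).support,
        energy c τ + ENNReal.ofReal G.S ≤ energy c σ := by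
    intro p h τ hτ
    rw [energy, energy, ← ENNReal.ofReal_add (coopWealth_ge (hS.le.trans hc)
      (admissible_of_ring hc hσ hτ)) hS.le, h τ hτ]
    exact ENNReal.ofReal_le_ofReal (by linarith)
  rcases hij.lt_or_gt with hlt | hlt
  · exact ⟨⟨(i, j), hlt⟩, key _ fun τ hτ => coopWealth_of_exploitation hij hia hja hpos
      (Or.inl ⟨hi.1, hj.1⟩) hτ⟩
  · exact ⟨⟨(j, i), hlt⟩, key _ fun τ hτ => coopWealth_of_exploitation hij.symm hja hia hpos.symm
      (Or.inr ⟨hj.1, hi.1⟩) hτ⟩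

variable [NeZero K]

variable (K) in
/-- The probability that the next ring moves a given individual in a given direction. -/
noncomputable def shiftProb (A : Parameters) : ℝ≥0 := A.d / totalRate K A / 4

variable (K) in
/-- The probability that the next ring is the game clock of a given pair. -/
noncomputable def gameProb (A : Parameters) : ℝ≥0 := A.v / totalRate K A

lemma shiftProb_pos (A : Parameters) : 0 < shiftProb K A :=
  div_pos (div_pos A.d_pos (totalRate_pos A)) (by norm_num)

lemma gameProb_pos (A : Parameters) : 0 < gameProb K A :=
  div_pos A.v_pos (totalRate_pos A)

lemma clockLaw_move (A : Parameters) (i : Fin K) :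
    clockLaw K A (.move i) * 4⁻¹ = shiftProb K A := by
  have h : clockLaw K A (.move i) = ((A.d / totalRate K A : ℝ≥0) : ℝ≥0∞) := rfl
  rw [h, shiftProb, ENNReal.coe_div (r := 4) (by norm_num), div_eq_mul_inv]
  rfl

lemma clockLaw_game (A : Parameters) (p : Pair K) :
    clockLaw K A (.game p) = gameProb K A := rfl

lemma shiftProb_le_one (A : Parameters) : shiftProb K A ≤ 1 := by
  have h : ((shiftProb K A : ℝ≥0) : ℝ≥0∞) ≤ 1 := by
    rw [← clockLaw_move A 0]
    exact mul_le_one' (PMF.coe_le_one _ _) (by simp)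
  exact_mod_cast h

/-- One ring brings a pair at distance `r + 1` to distance `r` with probability at least
`shiftProb K A`. -/
lemma shiftProb_mul_le_mean_near [NeZero m] (A : Parameters) (G : Payoffs) (σ : Config m K)
    (r : ℕ) : shiftProb K A * (near m K (r + 1)).indicator 1 σ ≤
      mean (stepLaw A G σ) ((near m K r).indicator 1) := by
  by_cases hσ : σ ∈ near m K (r + 1)
  swap
  · simp [hσ]
  obtain ⟨i, e, h⟩ := exists_shift_mem_near hσ
  have h4 : Fintype.card Direction = 4 := rfl
  calc (shiftProb K A : ℝ≥0∞) * (near m K (r + 1)).indicator 1 σ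
      = clockLaw K A (.move i) * (PMF.uniformOfFintype Direction e *
          ((near m K r).indicator 1 ∘ shift σ i) e) := by
        rw [PMF.uniformOfFintype_apply, h4, Function.comp_apply, Set.indicator_of_mem h,
          Set.indicator_of_mem hσ, ← clockLaw_move A i]
        simp
    _ ≤ clockLaw K A (.move i) * mean (ringLaw A G σ (.move i)) ((near m K r).indicator 1) := by
        refine mul_le_mul_right ?_ _
        simp only [ringLaw, moveLaw, mean_map]
        exact apply_mul_le_mean _ _ e
    _ ≤ _ := by
        rw [stepLaw, mean_bind]
        exact apply_mul_le_mean _ (fun k => mean (ringLaw A G σ k) _) (Clock.move i)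

lemma mean_energy_stepLaw_le [NeZero m] (A : Parameters) (G : Payoffs) {c : ℝ} (hc : G.S ≤ c)
    {σ : Config m K} (hσ : σ ∈ admissible m K c) :
    mean (stepLaw A G σ) (energy c) +
        ENNReal.ofReal G.S * gameProb K A * (near m K 0).indicator 1 σ ≤
      energy c σ + ENNReal.ofReal (2 * G.R) * (livingCooperatorSet m K).indicator 1 σ := by
  set B := energy c σ + ENNReal.ofReal (2 * G.R) * (livingCooperatorSet m K).indicator 1 σ
    with hB
  have hring : ∀ k, ∀ τ ∈ (ringLaw A G σ k).support, energy c τ ≤ B := by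
    intro k τ hτ
    have h := coopWealth_le_of_ring hτ
    by_cases hl : σ ∈ livingCooperatorSet m K
    · simp only [hl, Set.indicator_of_mem, Pi.one_apply, mul_one] at h
      simp only [hB, hl, Set.indicator_of_mem, Pi.one_apply, mul_one]
      exact (ENNReal.ofReal_le_ofReal (by linarith)).trans ENNReal.ofReal_add_le
    · simp only [hl, Set.indicator_of_notMem, not_false_eq_true, mul_zero, add_zero] at h
      simp only [hB, hl, Set.indicator_of_notMem, not_false_eq_true, mul_zero, add_zero]
      exact ENNReal.ofReal_le_ofReal (by linarith)
  have hmean : ∀ k, mean (ringLaw A G σ k) (energy c) ≤ B := fun k =>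
    (mean_mono (hring k)).trans (mean_const _ B).le
  rw [stepLaw, mean_bind]
  by_cases h0 : σ ∈ near m K 0
  · obtain ⟨p, hp⟩ := exists_game_energy_add_le A G hc hσ h0
    have hgame : mean (ringLaw A G σ (.game p)) (energy c) + ENNReal.ofReal G.S ≤ B := by
      rw [← mean_const (ringLaw A G σ (.game p)) (ENNReal.ofReal G.S), ← mean_add]
      refine (mean_mono hp).trans ?_
      rw [mean_const]
      exact le_self_add
    let f : Clock K → ℝ≥0∞ := fun k => if k = .game p then ENNReal.ofReal G.S else 0
    have hf : ENNReal.ofReal G.S * gameProb K A ≤ mean (clockLaw K A) f := by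
      have := apply_mul_le_mean (clockLaw K A) f (.game p)
      simp only [f, if_true] at this
      rwa [clockLaw_game, mul_comm] at this
    simp only [h0, Set.indicator_of_mem, Pi.one_apply, mul_one]
    refine (add_le_add_right hf _).trans ?_
    rw [← mean_add]
    refine (mean_mono (g := fun _ => B) fun k _ => ?_).trans (mean_const _ B).le
    by_cases hk : k = .game p
    · simpa [f, hk] using hgame
    · simpa [f, hk] using hmean k
  · simp only [h0, Set.indicator_of_notMem, not_false_eq_true, mul_zero, add_zero]
    exact (mean_mono fun k _ => hmean k).trans (mean_const _ B).le

lemma marginal_support_subset (A : Parameters) (G : Payoffs) {c : ℝ} (hc : G.S ≤ c)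
    {σ : Config m K} (hσ : σ ∈ admissible m K c) (n : ℕ) :
    (marginal A G σ n).support ⊆ admissible m K c := by
  induction n with
  | zero =>
    intro τ hτ
    rw [marginal, PMF.mem_support_pure_iff] at hτ
    exact hτ ▸ hσ
  | succ n ih =>
    intro τ hτ
    rw [marginal, PMF.mem_support_bind_iff] at hτ
    obtain ⟨ρ, hρ, hτ⟩ := hτ
    rw [stepLaw, PMF.mem_support_bind_iff] at hτ
    obtain ⟨k, -, hτ⟩ := hτ
    exact admissible_of_ring hc (ih hρ) hτ

/-- The probability that the `n`-th configuration of the jump chain is in `s`. -/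
noncomputable def probAt (A : Parameters) (G : Payoffs) (σ : Config m K) (s : Set (Config m K))
    (n : ℕ) : ℝ≥0∞ :=
  mean (marginal A G σ n) (s.indicator 1)

lemma probAt_le_one (A : Parameters) (G : Payoffs) (σ : Config m K) (s : Set (Config m K))
    (n : ℕ) : probAt A G σ s n ≤ 1 := by
  refine (mean_mono (g := fun _ => 1) fun a _ => ?_).trans (mean_const _ 1).le
  exact Set.indicator_le_self s 1 a

lemma chainLaw_mem_eq_probAt (A : Parameters) (G : Payoffs) (σ : Config m K)
    (s : Set (Config m K)) (n : ℕ) : chainLaw A G σ {ω | ω n ∈ s} = probAt A G σ s n := by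
  rw [probAt, mean_indicator, ← PMF.toMeasure_apply_eq_toOuterMeasure_apply _ (s := s) trivial,
    ← map_eval_chainLaw, Measure.map_apply (measurable_pi_apply n) (MeasurableSet.of_discrete)]
  rfl

lemma energy_add_sum_probAt_le [NeZero m] (A : Parameters) (G : Payoffs) {c : ℝ} (hc : G.S ≤ c)
    {σ : Config m K} (hσ : σ ∈ admissible m K c) (N : ℕ) :
    mean (marginal A G σ N) (energy c) + ENNReal.ofReal G.S * gameProb K A *
        ∑ n ∈ Finset.range N, probAt A G σ (near m K 0) n ≤
      energy c σ + ENNReal.ofReal (2 * G.R) *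
        ∑ n ∈ Finset.range N, probAt A G σ (livingCooperatorSet m K) n := by
  induction N with
  | zero => simp [marginal, mean_pure]
  | succ N ih =>
    have hstep : mean (marginal A G σ (N + 1)) (energy c) +
          ENNReal.ofReal G.S * gameProb K A * probAt A G σ (near m K 0) N ≤
        mean (marginal A G σ N) (energy c) +
          ENNReal.ofReal (2 * G.R) * probAt A G σ (livingCooperatorSet m K) N := by
      rw [marginal, mean_bind, probAt, probAt, ← mean_const_mul, ← mean_const_mul, ← mean_add,
        ← mean_add]
      exact mean_mono fun τ hτ =>
        mean_energy_stepLaw_le A G hc (marginal_support_subset A G hc hσ N hτ)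
    rw [Finset.sum_range_succ, Finset.sum_range_succ, mul_add, mul_add]
    calc _ = (mean (marginal A G σ (N + 1)) (energy c) +
              ENNReal.ofReal G.S * gameProb K A * probAt A G σ (near m K 0) N) +
            ENNReal.ofReal G.S * gameProb K A *
              ∑ n ∈ Finset.range N, probAt A G σ (near m K 0) n := by ring
      _ ≤ (mean (marginal A G σ N) (energy c) +
              ENNReal.ofReal (2 * G.R) * probAt A G σ (livingCooperatorSet m K) N) +
            ENNReal.ofReal G.S * gameProb K A *
              ∑ n ∈ Finset.range N, probAt A G σ (near m K 0) n := by gcongr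
      _ = (mean (marginal A G σ N) (energy c) + ENNReal.ofReal G.S * gameProb K A *
              ∑ n ∈ Finset.range N, probAt A G σ (near m K 0) n) +
            ENNReal.ofReal (2 * G.R) * probAt A G σ (livingCooperatorSet m K) N := by ring
      _ ≤ (energy c σ + ENNReal.ofReal (2 * G.R) *
              ∑ n ∈ Finset.range N, probAt A G σ (livingCooperatorSet m K) n) +
            ENNReal.ofReal (2 * G.R) * probAt A G σ (livingCooperatorSet m K) N := by gcongr
      _ = _ := by ring

lemma shiftProb_pow_mul_le [NeZero m] (A : Parameters) (G : Payoffs) (σ : Config m K) (r : ℕ) :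
    ∀ n, (shiftProb K A : ℝ≥0∞) ^ r * probAt A G σ (near m K r) n ≤
      probAt A G σ (near m K 0) (n + r) := by
  induction r with
  | zero => intro n; simp
  | succ r ih =>
    intro n
    have h : (shiftProb K A : ℝ≥0∞) * probAt A G σ (near m K (r + 1)) n ≤
        probAt A G σ (near m K r) (n + 1) := by
      rw [probAt, probAt, marginal, mean_bind, ← mean_const_mul]
      exact mean_mono fun τ _ => shiftProb_mul_le_mean_near A G τ r
    calc (shiftProb K A : ℝ≥0∞) ^ (r + 1) * probAt A G σ (near m K (r + 1)) n
        = (shiftProb K A : ℝ≥0∞) ^ r *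
            (shiftProb K A * probAt A G σ (near m K (r + 1)) n) := by ring
      _ ≤ (shiftProb K A : ℝ≥0∞) ^ r * probAt A G σ (near m K r) (n + 1) := by gcongr
      _ ≤ probAt A G σ (near m K 0) (n + 1 + r) := ih _
      _ = _ := by rw [add_assoc, add_comm 1 r]

/-- As long as a cooperator lives, it shares a site with a living defector within the next `2 * m`
rings, with a probability bounded from below. -/
lemma shiftProb_pow_mul_probAt_le_sum [NeZero m] (A : Parameters) (G : Payoffs) {c : ℝ}
    (hc : G.S ≤ c) {σ : Config m K} (hσ : σ ∈ admissible m K c) (n : ℕ) :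
    (shiftProb K A : ℝ≥0∞) ^ (2 * m) * probAt A G σ (livingCooperatorSet m K) n ≤
      ∑ r ∈ Finset.range (2 * m), probAt A G σ (near m K 0) (n + r) := by
  have h : probAt A G σ (livingCooperatorSet m K) n ≤
      ∑ r ∈ Finset.range (2 * m), probAt A G σ (near m K r) n := by
    simp only [probAt]
    rw [← mean_finset_sum]
    refine mean_mono fun τ hτ => ?_
    by_cases hl : τ ∈ livingCooperatorSet m K
    · obtain ⟨r, hr, hτr⟩ := exists_mem_near (marginal_support_subset A G hc hσ n hτ) hl
      refine le_trans ?_ (Finset.single_le_sum (f := fun r => (near m K r).indicator 1 τ)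
        (fun _ _ => zero_le) (Finset.mem_range.2 hr))
      simp [hl, hτr]
    · simp [hl]
  refine (mul_le_mul_right h _).trans ?_
  rw [Finset.mul_sum]
  refine Finset.sum_le_sum fun r hr => ?_
  refine le_trans (mul_le_mul_left ?_ _) (shiftProb_pow_mul_le A G σ r n)
  exact pow_le_pow_right_of_le_one' (by exact_mod_cast shiftProb_le_one A) (Finset.mem_range.1 hr).le

end drift

/-- If the bad events `e` cost `s` each, the presence `c` of cooperators earns at most `ρ` per step,
and presence forces, with weight `δ`, a bad event within the next `L` steps, then the presence has
a bounded sum as soon as the losses outweigh the gains. -/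
lemma sum_le_of_drift {c e : ℕ → ℝ} {w s ρ δ : ℝ} {L : ℕ} (he : ∀ n, 0 ≤ e n)
    (he1 : ∀ n, e n ≤ 1)
    (hdrift : ∀ N, s * ∑ n ∈ Finset.range N, e n ≤ w + ρ * ∑ n ∈ Finset.range N, c n)
    (hge : ∀ n, δ * c n ≤ ∑ r ∈ Finset.range L, e (n + r)) (hs : 0 ≤ s) (hlt : ρ * L < s * δ)
    (N : ℕ) : ∑ n ∈ Finset.range N, c n ≤ (L * w + s * (L * L)) / (s * δ - ρ * L) := by
  have hshift : ∀ r ∈ Finset.range L,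
      ∑ n ∈ Finset.range N, e (n + r) ≤ ∑ n ∈ Finset.range N, e n + L := by
    intro r hr
    have h1 : ∑ n ∈ Finset.range N, e (n + r) ≤ ∑ n ∈ Finset.range (N + r), e n := by
      rw [add_comm N r, Finset.sum_range_add]
      simp only [add_comm r]
      exact le_add_of_nonneg_left (Finset.sum_nonneg fun n _ => he n)
    have h2 : ∑ n ∈ Finset.range r, e (N + n) ≤ r := by
      simpa using Finset.sum_le_sum fun n (_ : n ∈ Finset.range r) => he1 (N + n)
    have h3 : (r : ℝ) ≤ L := by exact_mod_cast (Finset.mem_range.1 hr).le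
    rw [Finset.sum_range_add] at h1
    linarith
  have hsum : δ * ∑ n ∈ Finset.range N, c n ≤ L * (∑ n ∈ Finset.range N, e n + L) := by
    rw [Finset.mul_sum]
    refine (Finset.sum_le_sum fun n _ => hge n).trans ?_
    rw [Finset.sum_comm]
    simpa [mul_add] using Finset.sum_le_sum hshift
  rw [le_div_iff₀ (by linarith)]
  have h1 := mul_le_mul_of_nonneg_left hsum hs
  have h2 := mul_le_mul_of_nonneg_left (hdrift N) (Nat.cast_nonneg (α := ℝ) L)
  linarith

/-! ### Extinction of the cooperators -/

section extinction

variable {m K : ℕ} [NeZero m] [NeZero K]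

lemma tsum_probAt_livingCooperatorSet_ne_top (A : Parameters) (G : Payoffs)
    (hS : 2 * (2 * m : ℕ) / (gameProb K A * shiftProb K A ^ (2 * m)) * G.R < G.S) {σ : Config m K}
    (hσ : ∃ i, IsLivingDefector σ i) :
    ∑' n, probAt A G σ (livingCooperatorSet m K) n ≠ ∞ := by
  have hS0 := G.P_pos.trans G.P_lt_S
  have hR := G.R_pos
  have hq : (0 : ℝ) < gameProb K A := NNReal.coe_pos.2 (gameProb_pos A)
  have hδ : (0 : ℝ) < (shiftProb K A : ℝ) ^ (2 * m) := pow_pos (NNReal.coe_pos.2 (shiftProb_pos A)) _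
  -- A cooperator in debt never plays again, so debts never exceed the initial ones or `S`.
  set c := G.S + ∑ i, |(σ i).wealth| with hc
  have hcS : G.S ≤ c := le_add_of_nonneg_right (Finset.sum_nonneg fun _ _ => abs_nonneg _)
  have hadm : σ ∈ admissible m K c := by
    refine ⟨hσ, fun i _ => ?_⟩
    have h1 : |(σ i).wealth| ≤ ∑ i, |(σ i).wealth| :=
      Finset.single_le_sum (f := fun i => |(σ i).wealth|) (fun _ _ => abs_nonneg _)
        (Finset.mem_univ i)
    have h2 := neg_abs_le (σ i).wealth
    linarith
  have henergy : energy c σ ≠ ∞ := ENNReal.ofReal_ne_top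
  have hfin : ∀ s n, probAt A G σ s n ≠ ∞ := fun s n =>
    ((probAt_le_one A G σ s n).trans_lt ENNReal.one_lt_top).ne
  set ce : ℕ → ℝ := fun n => (probAt A G σ (livingCooperatorSet m K) n).toReal with hce
  set ee : ℕ → ℝ := fun n => (probAt A G σ (near m K 0) n).toReal with hee
  have hdrift : ∀ N, G.S * gameProb K A * ∑ n ∈ Finset.range N, ee n ≤
      (energy c σ).toReal + 2 * G.R * ∑ n ∈ Finset.range N, ce n := by
    intro N
    have h := le_trans le_add_self (energy_add_sum_probAt_le A G hcS hadm N)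
    have hfinsum : ∑ n ∈ Finset.range N, probAt A G σ (livingCooperatorSet m K) n ≠ ∞ :=
      ENNReal.sum_ne_top.2 fun n _ => hfin _ n
    have hmul := ENNReal.mul_ne_top (ENNReal.ofReal_ne_top (r := 2 * G.R)) hfinsum
    have h' := ENNReal.toReal_mono (ENNReal.add_ne_top.2 ⟨henergy, hmul⟩) h
    rw [ENNReal.toReal_add henergy hmul, ENNReal.toReal_mul, ENNReal.toReal_mul,
      ENNReal.toReal_mul, ENNReal.toReal_ofReal hS0.le, ENNReal.toReal_ofReal (r := 2 * G.R) (by linarith),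
      ENNReal.toReal_sum fun n _ => hfin _ n, ENNReal.toReal_sum fun n _ => hfin _ n] at h'
    exact h'
  have hge : ∀ n, (shiftProb K A : ℝ) ^ (2 * m) * ce n ≤
      ∑ r ∈ Finset.range (2 * m), ee (n + r) := by
    intro n
    have h := ENNReal.toReal_mono (ENNReal.sum_ne_top.2 fun r _ => hfin _ (n + r))
      (shiftProb_pow_mul_probAt_le_sum A G hcS hadm n)
    rw [ENNReal.toReal_mul, ENNReal.toReal_pow, ENNReal.toReal_sum fun r _ => hfin _ (n + r)] at h
    exact h
  have hlt : 2 * G.R * (2 * m : ℕ) < G.S * gameProb K A * (shiftProb K A : ℝ) ^ (2 * m) := by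
    rw [div_mul_eq_mul_div, div_lt_iff₀ (mul_pos hq hδ)] at hS
    linarith
  have hbound := sum_le_of_drift (fun n => ENNReal.toReal_nonneg)
    (fun n => ENNReal.toReal_le_of_le_ofReal zero_le_one
      (by simpa using probAt_le_one A G σ (near m K 0) n)) hdrift hge
    (mul_pos hS0 hq).le hlt
  have hsum : Summable ce := summable_of_sum_range_le (fun n => ENNReal.toReal_nonneg) hbound
  have := hsum.tsum_ofReal_ne_top
  simpa only [hce, ENNReal.ofReal_toReal (hfin _ _)] using this

lemma ae_chainLaw_eventually_notMem (A : Parameters) (G : Payoffs)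
    (hS : 2 * (2 * m : ℕ) / (gameProb K A * shiftProb K A ^ (2 * m)) * G.R < G.S) {σ : Config m K}
    (hσ : ∃ i, IsLivingDefector σ i) :
    ∀ᵐ ω ∂chainLaw A G σ, ∀ᶠ n in atTop, ω n ∉ livingCooperatorSet m K := by
  have h := tsum_probAt_livingCooperatorSet_ne_top A G hS hσ
  simp only [← chainLaw_mem_eq_probAt] at h
  exact ae_eventually_notMem h

end extinction

end DemographicPD

theorem mainTheorem1 (m K : ℕ) [NeZero m] [NeZero K] (A : DemographicPD.Parameters) :
    ∃ μ : ℝ, 0 < μ ∧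
      ∀ G : DemographicPD.Payoffs, μ * G.R < G.S →
        ∀ σ : DemographicPD.Config m K, (∃ i : Fin K, DemographicPD.IsLivingDefector σ i) →
          ∀ᵐ ω ∂(DemographicPD.processLaw A G σ),
            ∃ t₀ : ℝ, 0 ≤ t₀ ∧ ∀ t : ℝ, t₀ ≤ t →
              ∀ i : Fin K, ¬ DemographicPD.IsLivingCooperator (DemographicPD.configAt t ω) i := by
  open DemographicPD in
  refine ⟨2 * (2 * m : ℕ) / (gameProb K A * shiftProb K A ^ (2 * m)), ?_, fun G hG σ hσ => ?_⟩
  · have hm : 0 < 2 * m := Nat.mul_pos two_pos (Nat.pos_of_ne_zero (NeZero.ne m))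
    have hq := gameProb_pos (K := K) A
    have hδ := shiftProb_pos (K := K) A
    positivity
  · have h1 : ∀ᵐ ω ∂processLaw A G σ, ∀ᶠ n in atTop, ω.1 n ∉ livingCooperatorSet m K :=
      Measure.quasiMeasurePreserving_fst.ae (ae_chainLaw_eventually_notMem A G hG hσ)
    have h2 : ∀ᵐ ω ∂processLaw A G σ, ∀ t : ℝ, ∃ n, t < ∑ k ∈ Finset.range (n + 1), ω.2 k :=
      Measure.quasiMeasurePreserving_snd.ae (ae_waitLaw_sum_unbounded K A)
    filter_upwards [h1, h2] with ω hω1 hω2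
    obtain ⟨t₀, h0, ht⟩ := exists_time_of_eventually (p := (· ∉ livingCooperatorSet m K)) hω2 hω1
    exact ⟨t₀, h0, fun t htt i hi => ht t htt ⟨i, hi⟩⟩
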